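/- **Setting.** A sender $\mathcal S$ and a receiver $\mathcal R$ are connected by $n$ channels, and there is no public channel. The message space $\mathcal M$ is finite with $|\mathcal M|\ge 2$. An SMT protocol $\Pi$ runs for a fixed number of rounds; in each round one of the two parties (according to a fixed schedule) sends, over every channel, a packet that is computed from its private random coins and the packets delivered to it so far (and, for $\mathcal S$, from the message $M_S\in\mathcal M$ to be sent). A packet contains a message or the blank symbol $\bot$, possibly together with the special message "DETECT". At the end $\mathcal R$ outputs $M_R$, which is a message in $\mathcal M$ or no message. Coins are drawn from discrete distributions, independently for all parties. A *$t$-adversary* $\mathcal A$ is computationally unbounded and randomized. It corrupts a set of at most $t$ channels, chosen from its coins. In every round it first sees the packets sent over the corrupted channels and then decides which packets are delivered on these channels. At the end it outputs a guess $M_A$. Its view $V_A(m,r_A)$ consists of the packets sent over the corrupted channels when $M_S=m$ and its coins are $r_A$. $\Pi$ is *$(\varepsilon,\delta)$-SMT against $\mathcal A$* if (correctness) for every $m\in\mathcal M$, if $M_S=m$ and the packets on the corrupted channels are not changed, then $\Pr[M_R=m]=1$; (privacy) for all $m_0,m_1\in\mathcal M$ and all coins $r_A$ of $\mathcal A$ of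 positive probability, the statistical distance of $V_A(m_0,r_A)$ and $V_A(m_1,r_A)$ is at most $\varepsilon$; (reliability) for every $m\in\mathcal M$, if $M_S=m$ then $\Pr[M_R\ne m]\le\delta$. In the *SMT game*, $M_S\in\mathcal M$ is uniformly random and $\Pi$ is run in the presence of $\mathcal A$. The outcome is $(\mathsf{guess},\mathsf{suc},\mathsf{detect})\in\{0,1\}^3$, where $\mathsf{guess}=1$ iff $M_A=M_S$, $\mathsf{suc}=1$ iff $M_R=M_S$, and $\mathsf{detect}=1$ iff $\mathcal S$ or $\mathcal R$ sends "DETECT" during the execution. For a utility function $U:\{0,1\}^3\to\mathbb R$, let $u(\mathcal A,U)$ be the expected value of $U$ at the outcome. $\Pi$ is *perfectly secure against a rational $t$-adversary with utility function $U$* if there is a $t$-adversary $\mathcal B$ such that $\Pi$ is $(0,0)$-SMT against $\mathcal B$, and $u(\mathcal A,U)\le u(\mathcal B,U)$ for every $t$-adversary $\mathcal A$. Let $U_{\mathsf{timid}}$ be the set of all $U$ such that, for all outcomes $\mathsf{out}=(\mathsf{guess},\mathsf{suc},\mathsf{detect})$ and $\mathsf{out}'=(\mathsf{guess}',\mathsf{suc}',\mathsf{detect}')$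 with $\mathsf{guess}=\mathsf{guess}'$: (1) $U(\mathsf{out})>U(\mathsf{out}')$ if $\mathsf{suc}<\mathsf{suc}'$ and $\mathsf{detect}=\mathsf{detect}'$; (2) $U(\mathsf{out})>U(\mathsf{out}')$ if $\mathsf{suc}=\mathsf{suc}'$ and $\mathsf{detect}<\mathsf{detect}'$. **Corollary.** Let $t\ge\lceil n/2\rceil$. There is no SMT protocol over $n$ channels without a public channel that, for every $U\in U_{\mathsf{timid}}$, is perfectly secure against a rational $t$-adversary with utility function $U$. -/

import Mathlib

namespace SMT

universe u

/-- The two honest parties. -/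
inductive Party where
  | sender
  | receiver

/-- What travels over one channel in one round: a message (`none` is the blank symbol `⊥`, i.e.
nothing is delivered), possibly accompanied by the special message "DETECT". -/
structure Packet (Msg : Type u) where
  body : Option Msg
  detect : Bool

/-- A protocol with message space `M` over `n` channels and no public channel.  All communication
consists of packets sent over the `n` channels.  In round `j < rounds`, the party `speaker j`
sends one packet over every channel.

A party is a function of its private coins, of the packets that were delivered to it in the
earlier rounds (most recent round first) and of the index of the current round; the sender also
has the message to be transmitted.  After the last round the receiver outputs a message, or
`none` if it outputs no message. -/
structure Protocol (M : Type u) (n : ℕ) where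
  Msg : Type u
  SCoins : Type u
  RCoins : Type u
  sCoins : PMF SCoins
  rCoins : PMF RCoins
  rounds : ℕ
  speaker : ℕ → Party
  sendS : M → SCoins → List (Fin n → Packet Msg) → ℕ → Fin n → Packet Msg
  sendR : RCoins → List (Fin n → Packet Msg) → ℕ → Fin n → Packet Msg
  output : RCoins → List (Fin n → Packet Msg) → Option M

variable {M : Type u} {n t : ℕ}

/-- A (computationally unbounded, rushing) `t`-adversary for the protocol `P`.  Depending on its
coins `r` it corrupts a set of at most `t` channels.  In each round (of either party) it sees the
packets sent over the corrupted channels, and only then chooses the packets delivered on these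
channels: `tamper r past cur` where `cur` is what is sent in the current round over the
corrupted channels and `past` lists what was sent there before (most recent round first).
At the end it outputs a guess of the transmitted message (`none`: something not in `M`). -/
structure Adversary (P : Protocol M n) (t : ℕ) where
  Coins : Type u
  coins : PMF Coins
  corrupt : Coins → Finset (Fin n)
  card_corrupt_le : ∀ r, (corrupt r).card ≤ t
  tamper : (r : Coins) → List (corrupt r → Packet P.Msg) → (corrupt r → Packet P.Msg) →
    (corrupt r → Packet P.Msg)
  guess : (r : Coins) → List (corrupt r → Packet P.Msg) → Option M

/-- The adversary that corrupts the same channels as `A` and only eavesdrops. -/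
def Adversary.passive {P : Protocol M n} (A : Adversary P t) : Adversary P t :=
  { A with tamper := fun _ _ cur => cur }

/-- The state of an execution: the packets delivered to the sender and to the receiver, the packets
seen by the adversary on the set `I` of corrupted channels (most recent round first), and whether
an honest party has sent "DETECT". -/
structure State (n : ℕ) (Msg : Type u) (I : Finset (Fin n)) where
  toS : List (Fin n → Packet Msg)
  toR : List (Fin n → Packet Msg)
  seen : List (I → Packet Msg)
  detected : Bool

namespace Protocol

/-- What is delivered when `p` is sent and the adversary puts `q` on the channels of `I`. -/
def deliver {Msg : Type u} (I : Finset (Fin n)) (p : Fin n → Packet Msg) (q : I → Packet Msg) :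
    Fin n → Packet Msg :=
  fun i => if h : i ∈ I then q ⟨i, h⟩ else p i

variable (P : Protocol M n) (A : Adversary P t)

/-- One round (round `j`) of the execution. -/
def step (m : M) (cS : P.SCoins) (cR : P.RCoins) (r : A.Coins) (j : ℕ)
    (st : State n P.Msg (A.corrupt r)) : State n P.Msg (A.corrupt r) :=
  let p : Fin n → Packet P.Msg :=
    match P.speaker j with
    | Party.sender => P.sendS m cS st.toS j
    | Party.receiver => P.sendR cR st.toR j
  let cur : A.corrupt r → Packet P.Msg := fun i => p i
  let d := deliver (A.corrupt r) p (A.tamper r st.seen cur)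
  { toS := match P.speaker j with
      | Party.sender => st.toS
      | Party.receiver => d :: st.toS
    toR := match P.speaker j with
      | Party.sender => d :: st.toR
      | Party.receiver => st.toR
    seen := cur :: st.seen
    detected := st.detected || decide (∃ i, (p i).detect = true) }

/-- The state after the first `k` rounds. -/
def run (m : M) (cS : P.SCoins) (cR : P.RCoins) (r : A.Coins) :
    ℕ → State n P.Msg (A.corrupt r)
  | 0 => { toS := [], toR := [], seen := [], detected := false }
  | k + 1 => P.step A m cS cR r k (run m cS cR r k)

/-- The state at the end of the execution. -/
def final (m : M) (cS : P.SCoins) (cR : P.RCoins) (r : A.Coins) : State n P.Msg (A.corrupt r) :=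
  P.run A m cS cR r P.rounds

/-- The message `M_R` output by the receiver. -/
def received (m : M) (cS : P.SCoins) (cR : P.RCoins) (r : A.Coins) : Option M :=
  P.output cR (P.final A m cS cR r).toR

/-- The distribution of `M_R` when `M_S = m`, over the coins of all the parties. -/
noncomputable def receivedDist (m : M) : PMF (Option M) :=
  P.sCoins.bind fun cS => P.rCoins.bind fun cR => A.coins.map fun r => P.received A m cS cR r

/-- The distribution of the view `V_A(m, r)` of the adversary when `M_S = m` and the coins of the
adversary are `r`, over the coins of the honest parties. -/
noncomputable def viewDist (m : M) (r : A.Coins) : PMF (List (A.corrupt r → Packet P.Msg)) :=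
  P.sCoins.bind fun cS => P.rCoins.map fun cR => (P.final A m cS cR r).seen

end Protocol

/-- Statistical distance of two discrete distributions. -/
noncomputable def statDist {Ω : Type*} (p q : PMF Ω) : ℝ :=
  (1 / 2) * ∑' x, |(p x).toReal - (q x).toReal|

/-- `P` is an `(ε, δ)`-SMT protocol against the adversary `A`. -/
structure IsSMTAgainst (P : Protocol M n) (ε δ : ℝ) (A : Adversary P t) : Prop where
  correctness : ∀ m : M, P.receivedDist A.passive m (some m) = 1
  privacy : ∀ m₀ m₁ : M, ∀ r ∈ A.coins.support,
    statDist (P.viewDist A m₀ r) (P.viewDist A m₁ r) ≤ ε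
  reliability : ∀ m : M, ((P.receivedDist A m).toOuterMeasure {x | x ≠ some m}).toReal ≤ δ

/-- The outcome `(guess, suc, detect)` of the SMT game, with `false < true` for `0 < 1`. -/
structure Outcome where
  guess : Bool
  suc : Bool
  detect : Bool

open Classical in
/-- The outcome of the SMT game for given coins and a given transmitted message `m`. -/
noncomputable def Protocol.outcome (P : Protocol M n) (A : Adversary P t) (m : M)
    (cS : P.SCoins) (cR : P.RCoins) (r : A.Coins) : Outcome where
  guess := decide (A.guess r (P.final A m cS cR r).seen = some m)
  suc := decide (P.received A m cS cR r = some m)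
  detect := (P.final A m cS cR r).detected

/-- The distribution of the outcome of the SMT game, in which the message is uniform in `M`. -/
noncomputable def Protocol.game [Fintype M] [Nonempty M] (P : Protocol M n) (A : Adversary P t) :
    PMF Outcome :=
  (PMF.uniformOfFintype M).bind fun m => P.sCoins.bind fun cS => P.rCoins.bind fun cR =>
    A.coins.map fun r => P.outcome A m cS cR r

/-- The utility `u(A, U)`: the expected value of `U` at the outcome of the SMT game. -/
noncomputable def Protocol.utility [Fintype M] [Nonempty M] (P : Protocol M n)
    (A : Adversary P t) (U : Outcome → ℝ) : ℝ :=
  ∑ g : Bool, ∑ s : Bool, ∑ d : Bool, (P.game A ⟨g, s, d⟩).toReal * U ⟨g, s, d⟩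

/-- `P` is perfectly secure against a rational `t`-adversary with utility function `U`. -/
def Protocol.PerfectlySecureRational [Fintype M] [Nonempty M] (P : Protocol M n) (t : ℕ)
    (U : Outcome → ℝ) : Prop :=
  ∃ B : Adversary P t, IsSMTAgainst P 0 0 B ∧
    ∀ A : Adversary P t, P.utility A U ≤ P.utility B U

/-- The set of utility functions of timid adversaries. -/
def timid : Set (Outcome → ℝ) :=
  {U | (∀ o o' : Outcome, o.guess = o'.guess → o.suc < o'.suc → o.detect = o'.detect →
          U o > U o') ∧
       (∀ o o' : Outcome, o.guess = o'.guess → o.suc = o'.suc → o.detect < o'.detect →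
          U o > U o')}

end SMT

namespace SMT

namespace Protocol

universe u

/-! ### The mixed execution and its two explanations. -/

variable {M : Type u} {n t : ℕ}

/-! Since `n ≤ 2 * t`, the channels split into two sets of size at most `t`. Fix possible coins of
the honest parties and mix two senders: one set carries packets for `m'`, the other for `m ≠ m'`.
Corrupting either set can produce this same execution, with true message `m` or `m'` respectively
(`run_replay`), and the receiver gives the same output, so it is wrong in one case. The adversary
has those coins hard-wired, hence it is only certain to cause failure with some probability `q > 0`.

This is enough, because the utility may depend on the protocol: a witness `B` of security never
causes failure, so if success costs `L` its utility is at most `-L`, whereas the disrupting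
adversary gets at least `L * q - L - 1`. Taking `L = 2 / q` contradicts the optimality of `B`. -/

/-- The packets delivered in round `j` when nobody tampers and the packet on channel `i` is the one
that a sender with message `w i` would send. The histories of the two parties are `h.1`, `h.2`. -/
def mixedPackets (P : Protocol M n) (w : Fin n → M) (cS : P.SCoins) (cR : P.RCoins) (j : ℕ)
    (h : List (Fin n → Packet P.Msg) × List (Fin n → Packet P.Msg)) : Fin n → Packet P.Msg :=
  match P.speaker j with
  | Party.sender => fun i => P.sendS (w i) cS h.1 j i
  | Party.receiver => P.sendR cR h.2 j

/-- The packets received by the sender and by the receiver in the first rounds of the execution in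
which channel `i` is served by a sender with message `w i`. -/
def mixedRun (P : Protocol M n) (w : Fin n → M) (cS : P.SCoins) (cR : P.RCoins) :
    ℕ → List (Fin n → Packet P.Msg) × List (Fin n → Packet P.Msg)
  | 0 => ([], [])
  | k + 1 =>
    let h := mixedRun P w cS cR k
    match P.speaker k with
    | Party.sender => (h.1, P.mixedPackets w cS cR k h :: h.2)
    | Party.receiver => (P.mixedPackets w cS cR k h :: h.1, h.2)

/-- The deterministic adversary that delivers the packets `D j` on the channels of `K` in
round `j`. -/
noncomputable def replay (P : Protocol M n) (K : Finset (Fin n)) (hK : K.card ≤ t)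
    (D : ℕ → Fin n → Packet P.Msg) : Adversary P t where
  Coins := PUnit
  coins := PMF.pure PUnit.unit
  corrupt _ := K
  card_corrupt_le _ := hK
  tamper _ past _ := fun i => D past.length i
  guess _ _ := none

/-- If all the channels outside `K` carry the packets of a sender with message `x`, then an
adversary corrupting `K` can bring about the mixed execution when the message is `x`. -/
theorem run_replay (P : Protocol M n) (w : Fin n → M) (cS : P.SCoins) (cR : P.RCoins)
    (K : Finset (Fin n)) (hK : K.card ≤ t) (x : M) (hx : ∀ i ∉ K, w i = x) (r : PUnit) (k : ℕ) :
    let st := P.run (P.replay K hK fun j => P.mixedPackets w cS cR j (P.mixedRun w cS cR j))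
      x cS cR r k
    (st.toS, st.toR) = P.mixedRun w cS cR k ∧ st.seen.length = k := by
  induction k with
  | zero => exact ⟨rfl, rfl⟩
  | succ k ih =>
    obtain ⟨h, hl⟩ := ih
    have h1 := congrArg Prod.fst h
    have h2 := congrArg Prod.snd h
    dsimp only at h1 h2
    -- The length of `seen` is part of the induction because `replay` reads the round number off it.
    refine ⟨?_, by simp [run, step, hl]⟩
    have key : deliver K
        (match P.speaker k with
          | Party.sender => P.sendS x cS (P.mixedRun w cS cR k).1 k
          | Party.receiver => P.sendR cR (P.mixedRun w cS cR k).2 k)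
        (fun i => P.mixedPackets w cS cR k (P.mixedRun w cS cR k) i)
        = P.mixedPackets w cS cR k (P.mixedRun w cS cR k) := by
      funext i
      by_cases hi : i ∈ K
      · simp [deliver, hi]
      · simp only [deliver, hi, dite_false, mixedPackets]
        cases P.speaker k <;> simp [hx i hi]
    simp only [run, step, mixedRun, h1, h2]
    simp only [replay] at hl ⊢
    rw [hl, key]
    cases P.speaker k <;> rfl

/-- The right-hand side involves neither `K` nor `x`: the receiver cannot tell which side of the
split is corrupted. -/
theorem received_replay (P : Protocol M n) (w : Fin n → M) (cS : P.SCoins) (cR : P.RCoins)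
    (K : Finset (Fin n)) (hK : K.card ≤ t) (x : M) (hx : ∀ i ∉ K, w i = x) (r : PUnit) :
    P.received (P.replay K hK fun j => P.mixedPackets w cS cR j (P.mixedRun w cS cR j)) x cS cR r
      = P.output cR (P.mixedRun w cS cR P.rounds).2 := by
  have h := (run_replay P w cS cR K hK x hx r P.rounds).1
  exact congrArg (P.output cR) (congrArg Prod.snd h)

/-- If `n ≤ 2 * t` then no protocol is perfectly reliable against all `t`-adversaries. -/
theorem exists_adversary_received_ne [Nontrivial M] (P : Protocol M n) (hnt : n ≤ 2 * t) :
    ∃ (A : Adversary P t) (m : M), ∃ cS ∈ P.sCoins.support, ∃ cR ∈ P.rCoins.support,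
      ∃ r ∈ A.coins.support, P.received A m cS cR r ≠ some m := by
  obtain ⟨m, m', hm⟩ := exists_pair_ne M
  obtain ⟨cS, hcS⟩ := P.sCoins.support_nonempty
  obtain ⟨cR, hcR⟩ := P.rCoins.support_nonempty
  obtain ⟨I, hI, hI'⟩ : ∃ I : Finset (Fin n), I.card ≤ t ∧ Iᶜ.card ≤ t := by
    obtain ⟨I, -, hI⟩ := Finset.exists_subset_card_eq
      (s := (Finset.univ : Finset (Fin n))) (n := min n t) (by simp)
    refine ⟨I, by omega, ?_⟩
    rw [Finset.card_compl, hI, Fintype.card_fin]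
    omega
  let w : Fin n → M := fun i => if i ∈ I then m' else m
  have e := received_replay P w cS cR I hI m (fun i hi => by simp [w, hi]) PUnit.unit
  have e' := received_replay P w cS cR Iᶜ hI' m' (fun i hi => by
    have : i ∈ I := by simpa using hi
    simp [w, this]) PUnit.unit
  -- The common output is `m`, which is wrong when `m'` is sent, or it is already wrong for `m`.
  by_cases h : P.output cR (P.mixedRun w cS cR P.rounds).2 = some m
  · refine ⟨P.replay Iᶜ hI' fun j => P.mixedPackets w cS cR j (P.mixedRun w cS cR j),
      m', cS, hcS, cR, hcR, PUnit.unit, (PMF.mem_support_pure_iff _ _).2 rfl, e'.trans_ne ?_⟩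
    rw [h]
    simpa using hm
  · exact ⟨P.replay I hI fun j => P.mixedPackets w cS cR j (P.mixedRun w cS cR j),
      m, cS, hcS, cR, hcR, PUnit.unit, (PMF.mem_support_pure_iff _ _).2 rfl, e.trans_ne h⟩

/-! ### From probabilities to single executions. -/

variable [Fintype M] [Nonempty M]

theorem mem_support_game_iff (P : Protocol M n) (A : Adversary P t) (o : Outcome) :
    o ∈ (P.game A).support ↔ ∃ m, ∃ cS ∈ P.sCoins.support, ∃ cR ∈ P.rCoins.support,
      ∃ r ∈ A.coins.support, P.outcome A m cS cR r = o := by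
  simp only [game, PMF.mem_support_bind_iff, PMF.support_uniformOfFintype, Set.top_eq_univ,
    Set.mem_univ, PMF.mem_support_map_iff, true_and]

end Protocol

theorem IsSMTAgainst.received_eq {M : Type*} {n t : ℕ} {P : Protocol M n} {ε : ℝ}
    {B : Adversary P t} (h : IsSMTAgainst P ε 0 B) (m : M) {cS : P.SCoins}
    (hcS : cS ∈ P.sCoins.support) {cR : P.RCoins} (hcR : cR ∈ P.rCoins.support) {r : B.Coins}
    (hr : r ∈ B.coins.support) : P.received B m cS cR r = some m := by
  by_contra hne
  have h0 : ((P.receivedDist B m).toOuterMeasure {x | x ≠ some m}) = 0 := by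
    have hle := h.reliability m
    have h1 := le_antisymm hle ENNReal.toReal_nonneg
    rcases (ENNReal.toReal_eq_zero_iff _).1 h1 with h2 | h2
    · exact h2
    -- `toReal` also sends `∞` to `0`; this case is excluded since the total mass is `1`.
    · refine absurd h2 (ne_top_of_le_ne_top ENNReal.one_ne_top ?_)
      rw [PMF.toOuterMeasure_apply, ← (P.receivedDist B m).tsum_coe]
      exact ENNReal.tsum_le_tsum fun x => Set.indicator_le_self _ _ x
  rw [PMF.toOuterMeasure_apply_eq_zero_iff, Set.disjoint_left] at h0
  refine h0 (a := P.received B m cS cR r) ?_ hne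
  simp only [Protocol.receivedDist, PMF.mem_support_bind_iff, PMF.mem_support_map_iff]
  exact ⟨cS, hcS, cR, hcR, r, hr, rfl⟩

/-! ### Utility bounds. -/

theorem sum_pmf_outcome (p : PMF Outcome) :
    ∑ g : Bool, ∑ s : Bool, ∑ d : Bool, (p ⟨g, s, d⟩).toReal = 1 := by
  let e : Bool × Bool × Bool ≃ Outcome :=
    { toFun := fun x => ⟨x.1, x.2.1, x.2.2⟩
      invFun := fun o => (o.guess, o.suc, o.detect)
      left_inv := fun _ => rfl
      right_inv := fun _ => rfl }
  have h : ∑ x, p (e x) = 1 := by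
    rw [← tsum_fintype (L := .unconditional _), e.tsum_eq (fun o => p o)]
    exact p.tsum_coe
  have h' := congrArg ENNReal.toReal h
  rw [ENNReal.toReal_sum (fun x _ => p.apply_ne_top _)] at h'
  simp only [Fintype.sum_prod_type, ENNReal.toReal_one] at h'
  exact h'

/-- The utility of an adversary that loses `L` if the transmission succeeds and `1` if it is
detected. -/
def disruptiveUtility (L : ℝ) (o : Outcome) : ℝ :=
  -(if o.suc then L else 0) - (if o.detect then 1 else 0)

theorem disruptiveUtility_mem_timid {L : ℝ} (hL : 0 < L) : disruptiveUtility L ∈ timid := by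
  constructor
  · rintro ⟨g, s, d⟩ ⟨g', s', d'⟩ - h2 h3
    obtain ⟨rfl, rfl⟩ := Bool.lt_iff.1 h2
    dsimp only at h3
    subst h3
    simp only [disruptiveUtility, Bool.false_eq_true, if_true, if_false]
    linarith
  · rintro ⟨g, s, d⟩ ⟨g', s', d'⟩ - h2 h3
    obtain ⟨rfl, rfl⟩ := Bool.lt_iff.1 h3
    dsimp only at h2
    subst h2
    simp [disruptiveUtility]

section Utility

variable {M : Type*} {n t : ℕ} [Fintype M] [Nonempty M] {P : Protocol M n} {A : Adversary P t}

theorem utility_disruptiveUtility_le {L : ℝ} (h : ∀ o ∈ (P.game A).support, o.suc = true) :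
    P.utility A (disruptiveUtility L) ≤ -L := by
  have h0 : ∀ g d, P.game A ⟨g, false, d⟩ = 0 := fun g d => by
    by_contra hne
    exact Bool.false_ne_true (h _ ((PMF.mem_support_iff _ _).2 hne))
  have hs := sum_pmf_outcome (P.game A)
  have hp : ∀ o, 0 ≤ (P.game A o).toReal := fun o => ENNReal.toReal_nonneg
  simp only [Protocol.utility, Fintype.sum_bool, disruptiveUtility, h0, ENNReal.toReal_zero,
    if_true, Bool.false_eq_true, if_false] at hs ⊢
  have hL := congrArg (L * ·) hs
  linarith [hp ⟨true, true, true⟩, hp ⟨false, true, true⟩]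

/-- Success has probability at most one minus that of `o`, and detection costs at most `1`. -/
theorem le_utility_disruptiveUtility {L : ℝ} (hL : 0 ≤ L) {o : Outcome} (ho : o.suc = false) :
    L * (P.game A o).toReal - L - 1 ≤ P.utility A (disruptiveUtility L) := by
  obtain ⟨g, s, d⟩ := o
  obtain rfl : s = false := ho
  have hs := sum_pmf_outcome (P.game A)
  have hp : ∀ o, 0 ≤ (P.game A o).toReal := fun o => ENNReal.toReal_nonneg
  have hLp : ∀ o, 0 ≤ L * (P.game A o).toReal := fun o => mul_nonneg hL (hp o)
  simp only [Protocol.utility, Fintype.sum_bool, disruptiveUtility, if_true, Bool.false_eq_true,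
    if_false] at hs ⊢
  have hLs := congrArg (L * ·) hs
  have h1 := hLp ⟨true, false, true⟩
  have h2 := hLp ⟨true, false, false⟩
  have h3 := hLp ⟨false, false, true⟩
  have h4 := hLp ⟨false, false, false⟩
  have k1 := hp ⟨true, false, false⟩
  have k2 := hp ⟨false, false, false⟩
  have k3 := hp ⟨true, true, false⟩
  have k4 := hp ⟨false, true, false⟩
  cases g <;> cases d <;> linarith

end Utility

end SMT

theorem mainTheorem4 {M : Type*} [Fintype M] [Nontrivial M] (n t : ℕ)
    (ht : ⌈(n : ℝ) / 2⌉₊ ≤ t) :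
    ¬ ∃ P : SMT.Protocol M n, ∀ U ∈ SMT.timid, P.PerfectlySecureRational t U := by
  rintro ⟨P, hP⟩
  have hnt : n ≤ 2 * t := by
    have h := Nat.ceil_le.1 ht
    have h' : (n : ℝ) ≤ 2 * t := by linarith
    exact_mod_cast h'
  obtain ⟨A, m, cS, hcS, cR, hcR, r, hr, hne⟩ := P.exists_adversary_received_ne hnt
  have hmem : P.outcome A m cS cR r ∈ (P.game A).support :=
    (P.mem_support_game_iff A _).2 ⟨m, cS, hcS, cR, hcR, r, hr, rfl⟩
  have hsuc : (P.outcome A m cS cR r).suc = false := by simp [SMT.Protocol.outcome, hne]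
  have hq : 0 < (P.game A (P.outcome A m cS cR r)).toReal :=
    ENNReal.toReal_pos ((PMF.mem_support_iff _ _).1 hmem) (PMF.apply_ne_top _ _)
  set q := (P.game A (P.outcome A m cS cR r)).toReal with hq_def
  -- With `L = 2 / q` the lower bound for `A` becomes `1 - L`, above the bound `-L` for `B`.
  have hL : 0 < 2 / q := by positivity
  obtain ⟨B, hB, hopt⟩ := hP _ (SMT.disruptiveUtility_mem_timid hL)
  have hBle : P.utility B (SMT.disruptiveUtility (2 / q)) ≤ -(2 / q) := by
    refine SMT.utility_disruptiveUtility_le fun o ho => ?_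
    obtain ⟨m, cS, hcS, cR, hcR, r, hr, rfl⟩ := (P.mem_support_game_iff B o).1 ho
    simp [SMT.Protocol.outcome, hB.received_eq m hcS hcR hr]
  have hAle := SMT.le_utility_disruptiveUtility (A := A) hL.le hsuc
  rw [← hq_def, div_mul_cancel₀ _ hq.ne'] at hAle
  linarith [hopt A]
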